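/- Let $d\in\mathbb N$, $0<\beta\le d$, and let $Q_0=\prod_{i=1}^d[a_i,a_i+L)$ be a half-open cube in $\mathbb R^d$. Let $\mathcal D(Q_0)$ be the lattice of all dyadic cubes generated by $Q_0$, that is, of all cubes $Q=\prod_{i=1}^d[a_i+\ell n_i,\,a_i+\ell(n_i+1))$ with side length $\ell(Q)=\ell=2^kL$, $k\in\mathbb Z$, $n\in\mathbb Z^d$. For $E\subseteq\mathbb R^d$ put $$\mathcal H^{\beta,Q_0}_\infty(E)=\inf\Big\{\sum_{i=1}^\infty \ell(Q_i)^\beta : E\subseteq\bigcup_{i=1}^\infty Q_i,\ Q_i\in\mathcal D(Q_0)\Big\},$$ for $g\ge 0$ let $\int_\Omega g\,d\mathcal H^{\beta,Q_0}_\infty=\int_0^\infty \mathcal H^{\beta,Q_0}_\infty(\{x\in\Omega: g(x)>t\})\,dt$ be the Choquet integral, and let $$\mathcal M f(x)=\sup_{x\in Q\in\mathcal D(Q_0)}\frac1{\ell(Q)^\beta}\int_Q|f|\,d\mathcal H^{\beta,Q_0}_\infty .$$ Let $f:\mathbb R^d\to\mathbb R$ be an arbitrary function (no measurability or quasicontinuity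 is assumed) and let $\lambda>0$ be such that $\mathcal H^{\beta,Q_0}_\infty(\{x\in\mathbb R^d:\mathcal M f(x)>\lambda\})<\infty$. Then there is a countable collection $\{Q_k\}$ of pairwise disjoint cubes in $\mathcal D(Q_0)$ such that (i) $\bigcup_kQ_k=\{x\in\mathbb R^d:\mathcal M f(x)>\lambda\}$; (ii) $\{Q_k\}$ is the collection of all cubes of $\mathcal D(Q_0)$ that are maximal (with respect to inclusion) among those contained in $\{x\in\mathbb R^d:\mathcal M f(x)>\lambda\}$; (iii) $\lambda<\dfrac1{\ell(Q_k)^\beta}\displaystyle\int_{Q_k}|f|\,d\mathcal H^{\beta,Q_0}_\infty\le 2^\beta\lambda$ for every $k$; (iv) $|f(x)|\le\lambda$ for $\mathcal H^\beta$-almost every $x\notin\bigcup_kQ_k$, where $\mathcal H^\beta$ is the $\beta$-dimensional Hausdorff measure. -/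

import Mathlib

open MeasureTheory Set
open scoped ENNReal

noncomputable section

/-- A half-open cube of `ℝ^d` with sides parallel to the axes, given by its lower corner and its
side length. -/
structure HalfOpenCube (d : ℕ) where
  corner : EuclideanSpace ℝ (Fin d)
  side : ℝ
  side_pos : 0 < side

/-- The set of points of the cube: the product of the intervals `[aᵢ, aᵢ + ℓ)`. -/
def HalfOpenCube.toSet {d : ℕ} (Q : HalfOpenCube d) : Set (EuclideanSpace ℝ (Fin d)) :=
  {x | ∀ i, Q.corner i ≤ x i ∧ x i < Q.corner i + Q.side}

/-- The lattice `𝒟(Q₀)` of all dyadic cubes of `ℝ^d` generated by `Q₀`: for each integer `k`, the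
tiling of `ℝ^d` by cubes of side `2 ^ k * ℓ(Q₀)` that has the corner of `Q₀` as a vertex.
It is not restricted to the subcubes of `Q₀`. -/
def dyadicCubes {d : ℕ} (Q₀ : HalfOpenCube d) : Set (HalfOpenCube d) :=
  {Q | ∃ (k : ℤ) (n : Fin d → ℤ), Q.side = (2 : ℝ) ^ k * Q₀.side ∧
    ∀ i, Q.corner i = Q₀.corner i + Q.side * (n i : ℝ)}

/-- The dyadic Hausdorff content of dimension `β` generated by `Q₀`. -/
def dyadicContent {d : ℕ} (β : ℝ) (Q₀ : HalfOpenCube d)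
    (E : Set (EuclideanSpace ℝ (Fin d))) : ℝ≥0∞ :=
  ⨅ (c : ℕ → HalfOpenCube d) (_ : ∀ i, c i ∈ dyadicCubes Q₀) (_ : E ⊆ ⋃ i, (c i).toSet),
    ∑' i, ENNReal.ofReal ((c i).side ^ β)

/-- The Choquet integral `∫_Ω g dH = ∫₀^∞ H {x ∈ Ω | g x > t} dt` of a non-negative function `g`
with respect to a set function `H`. -/
def choquetIntegral {X : Type*} (H : Set X → ℝ≥0∞) (Ω : Set X) (g : X → ℝ) : ℝ≥0∞ :=
  ∫⁻ t in Ioi (0 : ℝ), H {x | x ∈ Ω ∧ t < g x}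

/-- The average `ℓ(Q)^{-β} ∫_Q |f|` of `f` over `Q` with respect to the dyadic content. -/
def dyadicAverage {d : ℕ} (β : ℝ) (Q₀ : HalfOpenCube d) (f : EuclideanSpace ℝ (Fin d) → ℝ)
    (Q : HalfOpenCube d) : ℝ≥0∞ :=
  choquetIntegral (dyadicContent β Q₀) Q.toSet (fun x => |f x|) / ENNReal.ofReal (Q.side ^ β)

/-- The dyadic maximal function of `f` with respect to the dyadic content. -/
def dyadicMaximal {d : ℕ} (β : ℝ) (Q₀ : HalfOpenCube d) (f : EuclideanSpace ℝ (Fin d) → ℝ)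
    (x : EuclideanSpace ℝ (Fin d)) : ℝ≥0∞ :=
  ⨆ (Q : HalfOpenCube d) (_ : Q ∈ dyadicCubes Q₀) (_ : x ∈ Q.toSet), dyadicAverage β Q₀ f Q

/-- The dyadic cubes contained in `S` that are maximal for inclusion among those. -/
def maximalDyadicCubes {d : ℕ} (Q₀ : HalfOpenCube d) (S : Set (EuclideanSpace ℝ (Fin d))) :
    Set (HalfOpenCube d) :=
  {Q | Q ∈ dyadicCubes Q₀ ∧ Q.toSet ⊆ S ∧
    ∀ R ∈ dyadicCubes Q₀, R.toSet ⊆ S → Q.toSet ⊆ R.toSet → R = Q}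

end

/-! ### Geometry of dyadic cubes -/

/-! Let S be the superlevel set of the maximal function. A dyadic cube has content `side ^ β`
(`le_dyadicContent_toSet`), so finiteness of the content of S bounds the cubes inside S, and S is
the disjoint union of its maximal ones. A parent with average above λ would itself lie in S; this
gives the upper bound in (iii).

The lower bound is the real issue: maximality refers to inclusion in S, not to the average. A
maximal Q is tiled by subcubes R with average above λ, but the content is not additive. Weights w(R)
= (ℓ(R)/ℓ(Q))^(d-β) repair this: ∑ w(R) H(R ∩ E) ≤ H(E) by `tsum_mul_dyadicContent_inter_le`, while
∑ w(R) ℓ(R)^β = ℓ(Q)^β because volumes add. Integrating over levels gives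
`lt_dyadicAverage_of_cover`.

For (iv) no differentiation theorem is used. Chebyshev on each dyadic cube and an infimum over
covers force the set where Mf ≤ λ and |f| > λ + 1/(n+1) to have content zero locally. -/

theorem HalfOpenCube.corner_mem {d : ℕ} (Q : HalfOpenCube d) : Q.corner ∈ Q.toSet :=
  fun _ => ⟨le_rfl, lt_add_of_pos_right _ Q.side_pos⟩

theorem HalfOpenCube.toSet_eq_preimage {d : ℕ} (Q : HalfOpenCube d) :
    Q.toSet = (WithLp.ofLp : EuclideanSpace ℝ (Fin d) → Fin d → ℝ) ⁻¹'
      (Set.pi univ fun i => Ico (Q.corner i) (Q.corner i + Q.side)) := by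
  ext x
  simp [HalfOpenCube.toSet]

theorem HalfOpenCube.measurableSet_toSet {d : ℕ} (Q : HalfOpenCube d) :
    MeasurableSet Q.toSet := by
  rw [Q.toSet_eq_preimage]
  exact (PiLp.volume_preserving_ofLp (Fin d)).measurable
    (MeasurableSet.univ_pi fun _ => measurableSet_Ico)

theorem HalfOpenCube.volume_toSet {d : ℕ} (Q : HalfOpenCube d) :
    volume Q.toSet = ENNReal.ofReal (Q.side ^ (d : ℝ)) := by
  rw [Q.toSet_eq_preimage, (PiLp.volume_preserving_ofLp (Fin d)).measure_preimage
    (MeasurableSet.univ_pi fun _ => measurableSet_Ico).nullMeasurableSet, Real.volume_pi_Ico]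
  simp [ENNReal.ofReal_pow Q.side_pos.le]

/-- Compare volumes. For d = 0 every cube is the whole space and the sides are unrelated. -/
theorem HalfOpenCube.side_le_of_subset {d : ℕ} (hd : 0 < d) {Q R : HalfOpenCube d}
    (h : Q.toSet ⊆ R.toSet) : Q.side ≤ R.side := by
  have h1 := measure_mono (μ := volume) h
  rw [Q.volume_toSet, R.volume_toSet,
    ENNReal.ofReal_le_ofReal_iff (Real.rpow_nonneg R.side_pos.le _)] at h1
  exact (Real.rpow_le_rpow_iff Q.side_pos.le R.side_pos.le (by exact_mod_cast hd)).1 h1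

theorem HalfOpenCube.ediam_toSet_le {d : ℕ} (hd : 0 < d) (Q : HalfOpenCube d) :
    Metric.ediam Q.toSet ≤ ENNReal.ofReal (d * Q.side) := by
  refine Metric.ediam_le fun x hx y hy => ?_
  rw [edist_dist]
  refine ENNReal.ofReal_le_ofReal ?_
  have hs := Q.side_pos
  have hd1 : (1 : ℝ) ≤ d := by exact_mod_cast hd
  rw [EuclideanSpace.dist_eq, Real.sqrt_le_iff]
  refine ⟨by positivity, ?_⟩
  calc ∑ i, dist (x i) (y i) ^ 2 ≤ ∑ _i : Fin d, Q.side ^ 2 := by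
        refine Finset.sum_le_sum fun i _ => ?_
        refine pow_le_pow_left₀ dist_nonneg ?_ 2
        rw [Real.dist_eq, abs_le]
        constructor <;> linarith [hx i, hy i, (hx i).1, (hx i).2, (hy i).1, (hy i).2]
    _ = d * Q.side ^ 2 := by simp
    _ ≤ (d * Q.side) ^ 2 := by
        rw [mul_pow]
        refine mul_le_mul_of_nonneg_right ?_ (by positivity)
        nlinarith

theorem countable_dyadicCubes {d : ℕ} (Q₀ : HalfOpenCube d) : (dyadicCubes Q₀).Countable := by
  choose k n hk hn using fun Q : dyadicCubes Q₀ => Q.2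
  have hinj : Function.Injective fun Q : dyadicCubes Q₀ => (k Q, n Q) := by
    intro Q R h
    simp only [Prod.mk.injEq] at h
    have hs : Q.1.side = R.1.side := by rw [hk, hk R, h.1]
    have hc : Q.1.corner = R.1.corner := by
      ext i
      rw [hn, hn R, h.2, hs]
    apply Subtype.ext
    rcases Q with ⟨⟨a, b, c⟩, hQ⟩
    rcases R with ⟨⟨a', b', c'⟩, hR⟩
    simp only at hs hc
    subst hs hc
    rfl
  exact hinj.countable

theorem exists_dyadicCube_mem {d : ℕ} (Q₀ : HalfOpenCube d) (k : ℤ)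
    (x : EuclideanSpace ℝ (Fin d)) :
    ∃ Q ∈ dyadicCubes Q₀, Q.side = (2 : ℝ) ^ k * Q₀.side ∧ x ∈ Q.toSet := by
  have hs : 0 < (2 : ℝ) ^ k * Q₀.side := mul_pos (by positivity) Q₀.side_pos
  set s := (2 : ℝ) ^ k * Q₀.side
  let n : Fin d → ℤ := fun i => ⌊(x i - Q₀.corner i) / s⌋
  refine ⟨⟨WithLp.toLp 2 fun i => Q₀.corner i + s * (n i : ℝ), s, hs⟩,
    ⟨k, n, rfl, fun i => rfl⟩, rfl, fun i => ?_⟩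
  have h1 : (n i : ℝ) ≤ (x i - Q₀.corner i) / s := Int.floor_le _
  have h2 : (x i - Q₀.corner i) / s < (n i : ℝ) + 1 := Int.lt_floor_add_one _
  rw [le_div_iff₀ hs] at h1
  rw [div_lt_iff₀ hs] at h2
  constructor
  · change Q₀.corner i + s * (n i : ℝ) ≤ x i
    linarith
  · change x i < Q₀.corner i + s * (n i : ℝ) + s
    linarith

/-- Measured from the corner of Q₀ in units of `Q.side`, all faces of both cubes have integer
coordinates, so the strict inequalities given by a common point sharpen to inclusion. -/
theorem dyadicCube_subset_of_side_le {d : ℕ} {Q₀ Q R : HalfOpenCube d}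
    (hQ : Q ∈ dyadicCubes Q₀) (hR : R ∈ dyadicCubes Q₀) (hs : Q.side ≤ R.side)
    {x : EuclideanSpace ℝ (Fin d)} (hxQ : x ∈ Q.toSet) (hxR : x ∈ R.toSet) :
    Q.toSet ⊆ R.toSet := by
  obtain ⟨k, n, hk, hn⟩ := hQ
  obtain ⟨l, m, hl, hm⟩ := hR
  have hkl : k ≤ l := by
    rw [hk, hl] at hs
    exact (zpow_le_zpow_iff_right₀ (by norm_num : (1 : ℝ) < 2)).1
      (le_of_mul_le_mul_right hs Q₀.side_pos)
  obtain ⟨p, rfl⟩ := Int.le.dest hkl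
  have hRs : R.side = Q.side * ((2 ^ p : ℤ) : ℝ) := by
    rw [hk, hl, zpow_add₀ (by norm_num)]
    push_cast
    rw [zpow_natCast]
    ring
  have hpos := Q.side_pos
  intro y hy i
  obtain ⟨a1, a2⟩ := hxQ i
  obtain ⟨b1, b2⟩ := hxR i
  obtain ⟨c1, c2⟩ := hy i
  rw [hn] at a1 a2 c1 c2
  rw [hm, hRs] at b1 b2 ⊢
  have e1 : 2 ^ p * m i < n i + 1 := by
    have : Q.side * ((2 ^ p * m i : ℤ) : ℝ) < Q.side * ((n i + 1 : ℤ) : ℝ) := by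
      push_cast at *
      linarith
    exact_mod_cast lt_of_mul_lt_mul_left this hpos.le
  have e2 : n i < 2 ^ p * m i + 2 ^ p := by
    have : Q.side * (n i : ℝ) < Q.side * ((2 ^ p * m i + 2 ^ p : ℤ) : ℝ) := by
      push_cast at *
      linarith
    exact_mod_cast lt_of_mul_lt_mul_left this hpos.le
  have f1 : Q.side * ((2 ^ p * m i : ℤ) : ℝ) ≤ Q.side * (n i : ℝ) :=
    mul_le_mul_of_nonneg_left (by exact_mod_cast Int.lt_add_one_iff.1 e1) hpos.le
  have f2 : Q.side * ((n i + 1 : ℤ) : ℝ) ≤ Q.side * ((2 ^ p * m i + 2 ^ p : ℤ) : ℝ) :=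
    mul_le_mul_of_nonneg_left (by exact_mod_cast Int.add_one_le_iff.2 e2) hpos.le
  push_cast at *
  constructor <;> linarith

theorem dyadicCube_eq_of_side_eq {d : ℕ} {Q₀ Q R : HalfOpenCube d}
    (hQ : Q ∈ dyadicCubes Q₀) (hR : R ∈ dyadicCubes Q₀) (hs : Q.side = R.side)
    {x : EuclideanSpace ℝ (Fin d)} (hxQ : x ∈ Q.toSet) (hxR : x ∈ R.toSet) : Q = R := by
  have h1 := dyadicCube_subset_of_side_le hQ hR hs.le hxQ hxR Q.corner_mem
  have h2 := dyadicCube_subset_of_side_le hR hQ hs.ge hxR hxQ R.corner_mem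
  have hc : Q.corner = R.corner := by
    ext i
    exact le_antisymm (h2 i).1 (h1 i).1
  rcases Q with ⟨a, b, c⟩
  rcases R with ⟨a', b', c'⟩
  simp only at hs hc
  subst hs hc
  rfl

theorem dyadicCube_subset_or_subset {d : ℕ} {Q₀ Q R : HalfOpenCube d}
    (hQ : Q ∈ dyadicCubes Q₀) (hR : R ∈ dyadicCubes Q₀)
    {x : EuclideanSpace ℝ (Fin d)} (hxQ : x ∈ Q.toSet) (hxR : x ∈ R.toSet) :
    Q.toSet ⊆ R.toSet ∨ R.toSet ⊆ Q.toSet :=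
  (le_total Q.side R.side).imp (fun h => dyadicCube_subset_of_side_le hQ hR h hxQ hxR)
    (fun h => dyadicCube_subset_of_side_le hR hQ h hxR hxQ)

theorem exists_dyadicCube_parent {d : ℕ} {Q₀ Q : HalfOpenCube d} (hQ : Q ∈ dyadicCubes Q₀) :
    ∃ P ∈ dyadicCubes Q₀, P.side = 2 * Q.side ∧ Q.toSet ⊆ P.toSet := by
  obtain ⟨k, n, hk, hn⟩ := id hQ
  obtain ⟨P, hP, hPs, hmem⟩ := exists_dyadicCube_mem Q₀ (k + 1) Q.corner
  have h2 : P.side = 2 * Q.side := by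
    rw [hPs, hk, zpow_add_one₀ (by norm_num)]
    ring
  exact ⟨P, hP, h2, dyadicCube_subset_of_side_le hQ hP (by linarith [Q.side_pos])
    Q.corner_mem hmem⟩

/-- In a family of dyadic cubes of bounded side, every cube lies in a maximal one. -/
theorem exists_maximal_dyadicCube {d : ℕ} (hd : 0 < d) {Q₀ : HalfOpenCube d}
    {𝓕 : Set (HalfOpenCube d)} (h𝓕 : 𝓕 ⊆ dyadicCubes Q₀) {B : ℝ} (hB : ∀ Q ∈ 𝓕, Q.side ≤ B)
    {Q : HalfOpenCube d} (hQ : Q ∈ 𝓕) :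
    ∃ M ∈ 𝓕, Q.toSet ⊆ M.toSet ∧ ∀ R ∈ 𝓕, M.toSet ⊆ R.toSet → R = M := by
  obtain ⟨N, hN⟩ := pow_unbounded_of_one_lt (B / Q₀.side) (one_lt_two (α := ℝ))
  let P : ℤ → Prop := fun k => ∃ R ∈ 𝓕, R.side = (2 : ℝ) ^ k * Q₀.side ∧ Q.toSet ⊆ R.toSet
  have hbdd : ∃ b : ℤ, ∀ z, P z → z ≤ b := by
    refine ⟨N, ?_⟩
    rintro z ⟨R, hR, hRs, -⟩
    have h1 := hB R hR
    rw [hRs] at h1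
    rw [div_lt_iff₀ Q₀.side_pos] at hN
    have h2 : (2 : ℝ) ^ z ≤ (2 : ℝ) ^ (N : ℤ) := by
      rw [zpow_natCast]
      exact le_of_mul_le_mul_right (h1.trans hN.le) Q₀.side_pos
    exact (zpow_le_zpow_iff_right₀ (by norm_num : (1 : ℝ) < 2)).1 h2
  obtain ⟨k, n, hk, hn⟩ := h𝓕 hQ
  obtain ⟨m, ⟨M, hM, hMs, hQM⟩, hmax⟩ := Int.exists_greatest_of_bdd hbdd ⟨k, Q, hQ, hk, Subset.rfl⟩
  refine ⟨M, hM, hQM, fun R hR hMR => ?_⟩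
  obtain ⟨l, -, hl, -⟩ := h𝓕 hR
  have hlm : l ≤ m := hmax l ⟨R, hR, hl, hQM.trans hMR⟩
  have hRM : R.side ≤ M.side := by
    rw [hl, hMs]
    exact mul_le_mul_of_nonneg_right (zpow_le_zpow_right₀ (by norm_num) hlm) Q₀.side_pos.le
  exact dyadicCube_eq_of_side_eq (h𝓕 hR) (h𝓕 hM)
    (le_antisymm hRM (HalfOpenCube.side_le_of_subset hd hMR)) (hMR M.corner_mem) M.corner_mem

theorem disjoint_of_maximal {d : ℕ} {Q₀ Q R : HalfOpenCube d} {𝓕 : Set (HalfOpenCube d)}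
    (h𝓕 : 𝓕 ⊆ dyadicCubes Q₀) (hQ : Q ∈ 𝓕) (hR : R ∈ 𝓕)
    (hQmax : ∀ P ∈ 𝓕, Q.toSet ⊆ P.toSet → P = Q) (hRmax : ∀ P ∈ 𝓕, R.toSet ⊆ P.toSet → P = R)
    (hne : Q ≠ R) : Disjoint Q.toSet R.toSet := by
  rw [Set.disjoint_left]
  intro x hxQ hxR
  rcases dyadicCube_subset_or_subset (h𝓕 hQ) (h𝓕 hR) hxQ hxR with h | h
  · exact hne (hQmax R hR h).symm
  · exact hne (hRmax Q hQ h)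

/-! ### The dyadic Hausdorff content -/

theorem exists_dyadicCube_side_rpow_le {d : ℕ} {β : ℝ} (hβ : 0 < β) (Q₀ : HalfOpenCube d)
    {ε : ℝ} (hε : 0 < ε) : ∃ Q ∈ dyadicCubes Q₀, Q.side ^ β ≤ ε := by
  have hL := Q₀.side_pos
  have hy : 0 < ε ^ (1 / β) / Q₀.side := div_pos (Real.rpow_pos_of_pos hε _) hL
  obtain ⟨N, hN⟩ := exists_pow_lt_of_lt_one hy (by norm_num : (1 / 2 : ℝ) < 1)
  obtain ⟨Q, hQ, hQs, -⟩ := exists_dyadicCube_mem Q₀ (-(N : ℤ)) Q₀.corner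
  refine ⟨Q, hQ, ?_⟩
  rw [lt_div_iff₀ hL] at hN
  have h1 : Q.side ≤ ε ^ (1 / β) := by
    rw [hQs, zpow_neg, zpow_natCast, ← inv_pow, ← one_div]
    exact hN.le
  calc Q.side ^ β ≤ (ε ^ (1 / β)) ^ β := Real.rpow_le_rpow Q.side_pos.le h1 hβ.le
    _ = ε := by rw [← Real.rpow_mul hε.le, one_div_mul_cancel hβ.ne', Real.rpow_one]

theorem dyadicContent_mono {d : ℕ} {β : ℝ} {Q₀ : HalfOpenCube d}
    {E F : Set (EuclideanSpace ℝ (Fin d))} (h : E ⊆ F) :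
    dyadicContent β Q₀ E ≤ dyadicContent β Q₀ F :=
  le_iInf₂ fun c hc => le_iInf fun hF => iInf₂_le_of_le c hc (iInf_le _ (h.trans hF))

/-- The definition admits only sequences of genuine cubes. Finite or empty families are padded with
infinitely many tiny cubes of total cost at most ε. -/
theorem dyadicContent_le_tsum {d : ℕ} {β : ℝ} (hβ : 0 < β) {Q₀ : HalfOpenCube d}
    {E : Set (EuclideanSpace ℝ (Fin d))} {ι : Type*} [Countable ι] (c : ι → HalfOpenCube d)
    (hc : ∀ i, c i ∈ dyadicCubes Q₀) (hE : E ⊆ ⋃ i, (c i).toSet) :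
    dyadicContent β Q₀ E ≤ ∑' i, ENNReal.ofReal ((c i).side ^ β) := by
  refine ENNReal.le_of_forall_pos_le_add fun ε hε _ => ?_
  obtain ⟨δ, hδ, hsum⟩ := ENNReal.exists_pos_sum_of_countable
    (ENNReal.coe_ne_zero.2 hε.ne') ℕ
  choose e he hes using fun n => exists_dyadicCube_side_rpow_le hβ Q₀ (NNReal.coe_pos.2 (hδ n))
  obtain ⟨φ⟩ : Nonempty (ℕ ≃ ι ⊕ ℕ) := by
    have : Countable (ι ⊕ ℕ) := inferInstance
    obtain ⟨_⟩ := nonempty_denumerable (ι ⊕ ℕ)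
    exact ⟨(Denumerable.eqv (ι ⊕ ℕ)).symm⟩
  let b : ι ⊕ ℕ → HalfOpenCube d := Sum.elim c e
  have hb : ∀ j, b j ∈ dyadicCubes Q₀ := by
    rintro (i | n)
    exacts [hc i, he n]
  have hcov : E ⊆ ⋃ n, (b (φ n)).toSet := by
    intro x hx
    obtain ⟨i, hi⟩ := mem_iUnion.1 (hE hx)
    refine mem_iUnion.2 ⟨φ.symm (.inl i), ?_⟩
    simpa [b] using hi
  refine (iInf₂_le_of_le (fun n => b (φ n)) (fun n => hb _) (iInf_le _ hcov)).trans ?_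
  rw [φ.tsum_eq fun j => ENNReal.ofReal ((b j).side ^ β),
    Summable.tsum_sum ENNReal.summable ENNReal.summable]
  refine add_le_add le_rfl (le_trans (ENNReal.tsum_le_tsum fun n => ?_) hsum.le)
  exact (ENNReal.ofReal_le_ofReal (hes n)).trans_eq (ENNReal.ofReal_coe_nnreal)

theorem dyadicContent_toSet_le {d : ℕ} {β : ℝ} (hβ : 0 < β) {Q₀ Q : HalfOpenCube d}
    (hQ : Q ∈ dyadicCubes Q₀) : dyadicContent β Q₀ Q.toSet ≤ ENNReal.ofReal (Q.side ^ β) := by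
  simpa using dyadicContent_le_tsum hβ (fun _ : Unit => Q) (fun _ => hQ)
    (fun x hx => mem_iUnion.2 ⟨(), hx⟩)

theorem dyadicContent_empty {d : ℕ} {β : ℝ} (hβ : 0 < β) {Q₀ : HalfOpenCube d} :
    dyadicContent β Q₀ ∅ = 0 := by
  simpa using dyadicContent_le_tsum hβ (fun i : Empty => i.elim) (fun i => i.elim)
    (empty_subset _) (Q₀ := Q₀)

theorem exists_cover_of_dyadicContent_lt {d : ℕ} {β : ℝ} {Q₀ : HalfOpenCube d}
    {E : Set (EuclideanSpace ℝ (Fin d))} {a : ℝ≥0∞} (h : dyadicContent β Q₀ E < a) :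
    ∃ c : ℕ → HalfOpenCube d, (∀ i, c i ∈ dyadicCubes Q₀) ∧ E ⊆ ⋃ i, (c i).toSet ∧
      ∑' i, ENNReal.ofReal ((c i).side ^ β) < a := by
  simp only [dyadicContent, iInf_lt_iff] at h
  obtain ⟨c, hc, hE, h⟩ := h
  exact ⟨c, hc, hE, h⟩

theorem dyadicContent_iUnion_le {d : ℕ} {β : ℝ} (hβ : 0 < β) {Q₀ : HalfOpenCube d}
    (E : ℕ → Set (EuclideanSpace ℝ (Fin d))) :
    dyadicContent β Q₀ (⋃ i, E i) ≤ ∑' i, dyadicContent β Q₀ (E i) := by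
  refine ENNReal.le_of_forall_pos_le_add fun ε hε hfin => ?_
  obtain ⟨δ, hδ, hsum⟩ := ENNReal.exists_pos_sum_of_countable
    (ENNReal.coe_ne_zero.2 hε.ne') ℕ
  have hlt : ∀ i, dyadicContent β Q₀ (E i) < dyadicContent β Q₀ (E i) + δ i := fun i =>
    ENNReal.lt_add_right (ne_top_of_le_ne_top hfin.ne (ENNReal.le_tsum i))
      (ENNReal.coe_ne_zero.2 (hδ i).ne')
  choose c hc hE hs using fun i => exists_cover_of_dyadicContent_lt (hlt i)
  have hcov : (⋃ i, E i) ⊆ ⋃ p : ℕ × ℕ, (c p.1 p.2).toSet := by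
    refine iUnion_subset fun i x hx => ?_
    obtain ⟨j, hj⟩ := mem_iUnion.1 (hE i hx)
    exact mem_iUnion.2 ⟨(i, j), hj⟩
  refine (dyadicContent_le_tsum hβ _ (fun p : ℕ × ℕ => hc p.1 p.2) hcov).trans ?_
  rw [ENNReal.tsum_prod (f := fun i j => ENNReal.ofReal ((c i j).side ^ β))]
  refine (ENNReal.tsum_le_tsum fun i => (hs i).le).trans ?_
  rw [ENNReal.tsum_add]
  exact add_le_add le_rfl hsum.le

theorem rpow_sub_mul_rpow_le {a b β e : ℝ} (ha : 0 < a) (hab : a ≤ b) (h : β ≤ e) :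
    b ^ (β - e) * a ^ e ≤ a ^ β := by
  calc b ^ (β - e) * a ^ e ≤ a ^ (β - e) * a ^ e :=
        mul_le_mul_of_nonneg_right (Real.rpow_le_rpow_of_nonpos ha hab (by linarith))
          (Real.rpow_nonneg ha.le _)
    _ = a ^ β := by rw [← Real.rpow_add ha, sub_add_cancel]

/-- A Frostman condition: Lebesgue measure on Q, scaled to mass `Q.side ^ β`, gives each cube C at
most `C.side ^ β`. Such a measure bounds the content from below. -/
theorem ofReal_rpow_mul_volume_inter_le {d : ℕ} {β : ℝ} (hβ : 0 < β) (hβd : β ≤ (d : ℝ))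
    (Q C : HalfOpenCube d) :
    ENNReal.ofReal (Q.side ^ (β - d)) * volume (Q.toSet ∩ C.toSet) ≤
      ENNReal.ofReal (C.side ^ β) := by
  rcases le_total C.side Q.side with h | h
  · refine (mul_le_mul_right (measure_mono inter_subset_right) _).trans ?_
    rw [C.volume_toSet, ← ENNReal.ofReal_mul (Real.rpow_nonneg Q.side_pos.le _)]
    exact ENNReal.ofReal_le_ofReal (rpow_sub_mul_rpow_le C.side_pos h hβd)
  · refine (mul_le_mul_right (measure_mono inter_subset_left) _).trans ?_
    rw [Q.volume_toSet, ← ENNReal.ofReal_mul (Real.rpow_nonneg Q.side_pos.le _)]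
    exact ENNReal.ofReal_le_ofReal ((rpow_sub_mul_rpow_le Q.side_pos le_rfl hβd).trans
      (Real.rpow_le_rpow Q.side_pos.le h hβ.le))

theorem ofReal_rpow_mul_volume_toSet {d : ℕ} {β : ℝ} (Q : HalfOpenCube d) :
    ENNReal.ofReal (Q.side ^ (β - d)) * volume Q.toSet = ENNReal.ofReal (Q.side ^ β) := by
  rw [Q.volume_toSet, ← ENNReal.ofReal_mul (Real.rpow_nonneg Q.side_pos.le _),
    ← Real.rpow_add Q.side_pos, sub_add_cancel]

theorem le_dyadicContent_toSet {d : ℕ} {β : ℝ} (hβ : 0 < β) (hβd : β ≤ (d : ℝ))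
    (Q₀ Q : HalfOpenCube d) : ENNReal.ofReal (Q.side ^ β) ≤ dyadicContent β Q₀ Q.toSet := by
  refine le_iInf₂ fun c _ => le_iInf fun hcov => ?_
  rw [← ofReal_rpow_mul_volume_toSet Q]
  calc ENNReal.ofReal (Q.side ^ (β - d)) * volume Q.toSet
      ≤ ENNReal.ofReal (Q.side ^ (β - d)) * ∑' i, volume (Q.toSet ∩ (c i).toSet) := by
        refine mul_le_mul_right ((measure_mono ?_).trans (measure_iUnion_le _)) _
        rw [← inter_iUnion]
        exact subset_inter Subset.rfl hcov
    _ ≤ ∑' i, ENNReal.ofReal ((c i).side ^ β) := by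
        rw [← ENNReal.tsum_mul_left]
        exact ENNReal.tsum_le_tsum fun i => ofReal_rpow_mul_volume_inter_le hβ hβd Q (c i)

/-- A weighted superadditivity of the dyadic content over disjoint subcubes of a cube. -/
theorem tsum_mul_dyadicContent_inter_le {d : ℕ} {β : ℝ} (hβ : 0 < β) (hβd : β ≤ (d : ℝ))
    {Q₀ Q : HalfOpenCube d} {𝓡 : Set (HalfOpenCube d)} (h𝓡 : 𝓡 ⊆ dyadicCubes Q₀)
    (hsub : ∀ R ∈ 𝓡, R.toSet ⊆ Q.toSet)
    (hdisj : ∀ R ∈ 𝓡, ∀ R' ∈ 𝓡, R ≠ R' → Disjoint R.toSet R'.toSet)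
    (hside : ∀ R ∈ 𝓡, R.side ≤ Q.side)
    (E : Set (EuclideanSpace ℝ (Fin d))) :
    ∑' R : 𝓡, ENNReal.ofReal ((R.1.side / Q.side) ^ (d - β)) *
      dyadicContent β Q₀ (R.1.toSet ∩ E) ≤ dyadicContent β Q₀ E := by
  have hcount : Countable 𝓡 := ((countable_dyadicCubes Q₀).mono h𝓡).to_subtype
  have hw : ∀ R : 𝓡, ENNReal.ofReal ((R.1.side / Q.side) ^ (d - β)) ≤ 1 := fun R => by
    rw [ENNReal.ofReal_le_one]
    exact Real.rpow_le_one (div_pos R.1.side_pos Q.side_pos).le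
      ((div_le_one Q.side_pos).2 (hside R R.2)) (by linarith)
  have hwH : ∀ R : 𝓡, ENNReal.ofReal ((R.1.side / Q.side) ^ (d - β)) *
      dyadicContent β Q₀ R.1.toSet ≤ ENNReal.ofReal (Q.side ^ (β - d)) * volume R.1.toSet := by
    intro R
    refine (mul_le_mul_right (dyadicContent_toSet_le hβ (h𝓡 R.2)) _).trans_eq ?_
    have hR := R.1.side_pos
    rw [R.1.volume_toSet, ← ENNReal.ofReal_mul (by have := Q.side_pos; positivity),
      ← ENNReal.ofReal_mul (Real.rpow_nonneg Q.side_pos.le _),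
      Real.div_rpow hR.le Q.side_pos.le, div_eq_mul_inv, ← Real.rpow_neg Q.side_pos.le, neg_sub,
      mul_right_comm, ← Real.rpow_add hR, sub_add_cancel, mul_comm]
  have key : ∀ C ∈ dyadicCubes Q₀, ∑' R : 𝓡, ENNReal.ofReal ((R.1.side / Q.side) ^ (d - β)) *
      dyadicContent β Q₀ (R.1.toSet ∩ C.toSet) ≤ ENNReal.ofReal (C.side ^ β) := by
    intro C hC
    -- If C lies in some R, disjointness leaves one term, of weight at most 1. Otherwise each R
    -- meeting C lies inside C, and the terms are dominated by the scaled volume of Q ∩ C.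
    by_cases hex : ∃ R ∈ 𝓡, C.toSet ⊆ R.toSet
    · obtain ⟨R, hR, hCR⟩ := hex
      rw [tsum_eq_single ⟨R, hR⟩]
      · rw [← one_mul (ENNReal.ofReal (C.side ^ β))]
        exact mul_le_mul' (hw _)
          ((dyadicContent_mono inter_subset_right).trans (dyadicContent_toSet_le hβ hC))
      · intro R' hne
        have hd' : Disjoint R'.1.toSet C.toSet :=
          (hdisj R' R'.2 R hR fun h => hne (Subtype.ext h)).mono_right hCR
        rw [hd'.inter_eq, dyadicContent_empty hβ, mul_zero]
    · refine le_trans (ENNReal.tsum_le_tsum fun R => ?_)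
        (le_trans (b := ENNReal.ofReal (Q.side ^ (β - d)) * ∑' R : 𝓡, volume (R.1.toSet ∩ C.toSet))
          (ENNReal.tsum_mul_left (a := ENNReal.ofReal (Q.side ^ (β - d)))).le ?_)
      · rcases (R.1.toSet ∩ C.toSet).eq_empty_or_nonempty with h0 | ⟨x, hxR, hxC⟩
        · rw [h0, dyadicContent_empty hβ, mul_zero]
          exact zero_le
        · have hRC : R.1.toSet ⊆ C.toSet :=
            (dyadicCube_subset_or_subset (h𝓡 R.2) hC hxR hxC).resolve_right
              fun h => hex ⟨R, R.2, h⟩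
          rw [inter_eq_left.2 hRC]
          exact hwH R
      · rw [← measure_iUnion (fun (R R' : 𝓡) hne => (hdisj R R.2 R' R'.2
            fun h => hne (Subtype.ext h)).mono inter_subset_left inter_subset_left)
          (fun R : 𝓡 => R.1.measurableSet_toSet.inter C.measurableSet_toSet)]
        refine le_trans (mul_le_mul_right (measure_mono ?_) _)
          (ofReal_rpow_mul_volume_inter_le hβ hβd Q C)
        exact iUnion_subset fun R => inter_subset_inter_left _ (hsub R R.2)
  refine le_iInf₂ fun c hc => le_iInf fun hE => ?_
  calc ∑' R : 𝓡, ENNReal.ofReal ((R.1.side / Q.side) ^ (d - β)) *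
        dyadicContent β Q₀ (R.1.toSet ∩ E)
      ≤ ∑' R : 𝓡, ∑' i, ENNReal.ofReal ((R.1.side / Q.side) ^ (d - β)) *
        dyadicContent β Q₀ (R.1.toSet ∩ (c i).toSet) := by
        refine ENNReal.tsum_le_tsum fun R => ?_
        rw [ENNReal.tsum_mul_left]
        refine mul_le_mul_right (le_trans (dyadicContent_mono ?_)
          (dyadicContent_iUnion_le hβ _)) _
        rw [← inter_iUnion]
        exact inter_subset_inter_right _ hE
    _ ≤ ∑' i, ENNReal.ofReal ((c i).side ^ β) := by
        rw [ENNReal.tsum_comm]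
        exact ENNReal.tsum_le_tsum fun i => key _ (hc i)

/-! ### Choquet integrals and averages -/

/-- Monotonicity in the level supplies the measurability needed to exchange sum and integral, with
no regularity of the function. -/
theorem antitone_dyadicContent_superlevel {d : ℕ} (β : ℝ) (Q₀ : HalfOpenCube d)
    (Ω : Set (EuclideanSpace ℝ (Fin d))) (g : EuclideanSpace ℝ (Fin d) → ℝ) :
    Antitone fun s : ℝ => dyadicContent β Q₀ {x | x ∈ Ω ∧ s < g x} :=
  fun _ _ h => dyadicContent_mono fun _ hx => ⟨hx.1, h.trans_lt hx.2⟩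

theorem choquetIntegral_mono_set {d : ℕ} {β : ℝ} {Q₀ : HalfOpenCube d}
    {Ω Ω' : Set (EuclideanSpace ℝ (Fin d))} (h : Ω ⊆ Ω') (g : EuclideanSpace ℝ (Fin d) → ℝ) :
    choquetIntegral (dyadicContent β Q₀) Ω g ≤ choquetIntegral (dyadicContent β Q₀) Ω' g :=
  lintegral_mono fun _ => dyadicContent_mono fun _ hx => ⟨h hx.1, hx.2⟩

theorem ofReal_mul_le_choquetIntegral {d : ℕ} {β : ℝ} {Q₀ : HalfOpenCube d}
    {Ω A : Set (EuclideanSpace ℝ (Fin d))} {g : EuclideanSpace ℝ (Fin d) → ℝ} {s : ℝ}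
    (hA : A ⊆ Ω) (hg : ∀ x ∈ A, s < g x) :
    ENNReal.ofReal s * dyadicContent β Q₀ A ≤ choquetIntegral (dyadicContent β Q₀) Ω g := by
  calc ENNReal.ofReal s * dyadicContent β Q₀ A
      = ∫⁻ _ in Ioc (0 : ℝ) s, dyadicContent β Q₀ A := by
        rw [setLIntegral_const, Real.volume_Ioc, sub_zero, mul_comm]
    _ ≤ ∫⁻ u in Ioc (0 : ℝ) s, dyadicContent β Q₀ {x | x ∈ Ω ∧ u < g x} :=
        setLIntegral_mono' measurableSet_Ioc fun u hu =>
          dyadicContent_mono fun x hx => ⟨hA hx, hu.2.trans_lt (hg x hx)⟩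
    _ ≤ choquetIntegral (dyadicContent β Q₀) Ω g := lintegral_mono_set Ioc_subset_Ioi_self

theorem tsum_mul_choquetIntegral_le {d : ℕ} {β : ℝ} (hβ : 0 < β) (hβd : β ≤ (d : ℝ))
    {Q₀ Q : HalfOpenCube d} {𝓡 : Set (HalfOpenCube d)} (h𝓡 : 𝓡 ⊆ dyadicCubes Q₀)
    (hsub : ∀ R ∈ 𝓡, R.toSet ⊆ Q.toSet)
    (hdisj : ∀ R ∈ 𝓡, ∀ R' ∈ 𝓡, R ≠ R' → Disjoint R.toSet R'.toSet)
    (hside : ∀ R ∈ 𝓡, R.side ≤ Q.side) (g : EuclideanSpace ℝ (Fin d) → ℝ) :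
    ∑' R : 𝓡, ENNReal.ofReal ((R.1.side / Q.side) ^ (d - β)) *
      choquetIntegral (dyadicContent β Q₀) R.1.toSet g ≤
      choquetIntegral (dyadicContent β Q₀) Q.toSet g := by
  have hcount : Countable 𝓡 := ((countable_dyadicCubes Q₀).mono h𝓡).to_subtype
  have hanti : ∀ R : 𝓡, Antitone fun s : ℝ => dyadicContent β Q₀ {x | x ∈ R.1.toSet ∧ s < g x} :=
    fun R => antitone_dyadicContent_superlevel β Q₀ R.1.toSet g
  calc ∑' R : 𝓡, ENNReal.ofReal ((R.1.side / Q.side) ^ (d - β)) *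
        choquetIntegral (dyadicContent β Q₀) R.1.toSet g
      = ∫⁻ s in Ioi (0 : ℝ), ∑' R : 𝓡, ENNReal.ofReal ((R.1.side / Q.side) ^ (d - β)) *
          dyadicContent β Q₀ {x | x ∈ R.1.toSet ∧ s < g x} := by
        rw [lintegral_tsum fun R => ((hanti R).measurable.const_mul _).aemeasurable]
        exact tsum_congr fun R => (lintegral_const_mul _ (hanti R).measurable).symm
    _ ≤ choquetIntegral (dyadicContent β Q₀) Q.toSet g := by
        refine lintegral_mono fun s => le_trans (ENNReal.tsum_le_tsum fun R => ?_)
          (tsum_mul_dyadicContent_inter_le hβ hβd h𝓡 hsub hdisj hside {x | x ∈ Q.toSet ∧ s < g x})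
        refine mul_le_mul_right (dyadicContent_mono fun x hx => ?_) _
        exact ⟨hx.1, hsub R R.2 hx.1, hx.2⟩

theorem lt_dyadicAverage_iff {d : ℕ} {β : ℝ} {Q₀ : HalfOpenCube d}
    {f : EuclideanSpace ℝ (Fin d) → ℝ} {Q : HalfOpenCube d} {a : ℝ≥0∞} :
    a < dyadicAverage β Q₀ f Q ↔ a * ENNReal.ofReal (Q.side ^ β) <
      choquetIntegral (dyadicContent β Q₀) Q.toSet fun x => |f x| :=
  ENNReal.lt_div_iff_mul_lt
    (Or.inl (ENNReal.ofReal_pos.2 (Real.rpow_pos_of_pos Q.side_pos _)).ne')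
    (Or.inl ENNReal.ofReal_ne_top)

/-- If a dyadic cube is covered by dyadic subcubes over which the average exceeds `t`, then so does
the average over the cube itself. -/
theorem lt_dyadicAverage_of_cover {d : ℕ} {β : ℝ} (hβ : 0 < β) (hβd : β ≤ (d : ℝ))
    {Q₀ Q : HalfOpenCube d} {f : EuclideanSpace ℝ (Fin d) → ℝ} {t : ℝ}
    (hcov : ∀ x ∈ Q.toSet, ∃ R ∈ dyadicCubes Q₀, x ∈ R.toSet ∧ R.toSet ⊆ Q.toSet ∧
      ENNReal.ofReal t < dyadicAverage β Q₀ f R) :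
    ENNReal.ofReal t < dyadicAverage β Q₀ f Q := by
  have hd : 0 < d := by exact_mod_cast hβ.trans_le hβd
  let 𝓕 : Set (HalfOpenCube d) := {R | R ∈ dyadicCubes Q₀ ∧ R.toSet ⊆ Q.toSet ∧
    ENNReal.ofReal t < dyadicAverage β Q₀ f R}
  have h𝓕 : 𝓕 ⊆ dyadicCubes Q₀ := fun R hR => hR.1
  have hside : ∀ R ∈ 𝓕, R.side ≤ Q.side := fun R hR =>
    HalfOpenCube.side_le_of_subset hd hR.2.1
  let 𝓡 : Set (HalfOpenCube d) := {M | M ∈ 𝓕 ∧ ∀ R ∈ 𝓕, M.toSet ⊆ R.toSet → R = M}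
  have hdisj : ∀ R ∈ 𝓡, ∀ R' ∈ 𝓡, R ≠ R' → Disjoint R.toSet R'.toSet :=
    fun R hR R' hR' hne => disjoint_of_maximal h𝓕 hR.1 hR'.1 hR.2 hR'.2 hne
  have hcount : Countable 𝓡 :=
    ((countable_dyadicCubes Q₀).mono fun R hR => h𝓕 hR.1).to_subtype
  have hcov' : ∀ x ∈ Q.toSet, ∃ M ∈ 𝓡, x ∈ M.toSet := by
    intro x hx
    obtain ⟨R, hR, hxR, hRQ, hRt⟩ := hcov x hx
    obtain ⟨M, hM, hRM, hmax⟩ := exists_maximal_dyadicCube hd h𝓕 hside (Q := R) ⟨hR, hRQ, hRt⟩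
    exact ⟨M, ⟨hM, hmax⟩, hRM hxR⟩
  have hunion : ⋃ R : 𝓡, R.1.toSet = Q.toSet := by
    refine Subset.antisymm (iUnion_subset fun R => R.2.1.2.1) fun x hx => ?_
    obtain ⟨M, hM, hx⟩ := hcov' x hx
    exact mem_iUnion.2 ⟨⟨M, hM⟩, hx⟩
  -- Each summand is t times `Q.side ^ (β - d)` times the volume of R, and the maximal cubes R tile
  -- Q.
  have hsum : ∑' R : 𝓡, ENNReal.ofReal ((R.1.side / Q.side) ^ (d - β)) *
      (ENNReal.ofReal t * ENNReal.ofReal (R.1.side ^ β)) =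
      ENNReal.ofReal t * ENNReal.ofReal (Q.side ^ β) := by
    rw [← ofReal_rpow_mul_volume_toSet Q, ← hunion, measure_iUnion
      (fun (R R' : 𝓡) hne => hdisj R R.2 R' R'.2 fun h => hne (Subtype.ext h))
      (fun R : 𝓡 => R.1.measurableSet_toSet), ← ENNReal.tsum_mul_left, ← ENNReal.tsum_mul_left]
    refine tsum_congr fun R => ?_
    have hR := R.1.side_pos
    rw [mul_left_comm, R.1.volume_toSet, ← ENNReal.ofReal_mul (by have := Q.side_pos; positivity),
      ← ENNReal.ofReal_mul (Real.rpow_nonneg Q.side_pos.le _),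
      Real.div_rpow hR.le Q.side_pos.le, div_eq_mul_inv, ← Real.rpow_neg Q.side_pos.le, neg_sub,
      mul_right_comm, ← Real.rpow_add hR, sub_add_cancel, mul_comm (Q.side ^ _)]
  have hlt : ∀ R : 𝓡, ENNReal.ofReal ((R.1.side / Q.side) ^ (d - β)) *
      (ENNReal.ofReal t * ENNReal.ofReal (R.1.side ^ β)) <
      ENNReal.ofReal ((R.1.side / Q.side) ^ (d - β)) *
        choquetIntegral (dyadicContent β Q₀) R.1.toSet fun x => |f x| := fun R =>
    ENNReal.mul_lt_mul_right
      (ENNReal.ofReal_pos.2 (Real.rpow_pos_of_pos (div_pos R.1.side_pos Q.side_pos) _)).ne'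
      ENNReal.ofReal_ne_top (lt_dyadicAverage_iff.1 R.2.1.2.2)
  -- One actual member of the family makes the summed inequality strict.
  obtain ⟨M, hM, -⟩ := hcov' _ Q.corner_mem
  rw [lt_dyadicAverage_iff]
  calc ENNReal.ofReal t * ENNReal.ofReal (Q.side ^ β)
      < ∑' R : 𝓡, ENNReal.ofReal ((R.1.side / Q.side) ^ (d - β)) *
        choquetIntegral (dyadicContent β Q₀) R.1.toSet fun x => |f x| := by
        rw [← hsum]
        refine ENNReal.tsum_lt_tsum (i := ⟨M, hM⟩) ?_ (fun R => (hlt R).le) (hlt _)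
        rw [hsum]
        exact ENNReal.mul_ne_top ENNReal.ofReal_ne_top ENNReal.ofReal_ne_top
    _ ≤ _ := tsum_mul_choquetIntegral_le hβ hβd (fun R hR => h𝓕 hR.1)
        (fun R hR => hR.1.2.1) hdisj (fun R hR => hside R hR.1) _

theorem dyadicAverage_le_of_parent {d : ℕ} {β : ℝ} {Q₀ Q P : HalfOpenCube d}
    {f : EuclideanSpace ℝ (Fin d) → ℝ} {t : ℝ} (hP : P.side = 2 * Q.side)
    (hQP : Q.toSet ⊆ P.toSet) (hle : dyadicAverage β Q₀ f P ≤ ENNReal.ofReal t) :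
    dyadicAverage β Q₀ f Q ≤ ENNReal.ofReal ((2 : ℝ) ^ β * t) := by
  have h0 : ENNReal.ofReal (Q.side ^ β) ≠ 0 :=
    (ENNReal.ofReal_pos.2 (Real.rpow_pos_of_pos Q.side_pos _)).ne'
  have h2 : (0 : ℝ) ≤ 2 ^ β := by positivity
  have h1 := le_of_not_gt (mt lt_dyadicAverage_iff.2 hle.not_gt)
  refine ENNReal.div_le_of_le_mul ((choquetIntegral_mono_set hQP _).trans (h1.trans_eq ?_))
  rw [hP, Real.mul_rpow zero_le_two Q.side_pos.le, ENNReal.ofReal_mul h2, ENNReal.ofReal_mul h2]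
  ring

/-! ### Null sets -/

/-- A set of which each dyadic cube contains only a proportion bounded away from `1` has content
zero in every dyadic cube. -/
theorem dyadicContent_inter_eq_zero {d : ℕ} {β : ℝ} (hβ : 0 < β)
    {Q₀ : HalfOpenCube d} {A : Set (EuclideanSpace ℝ (Fin d))} {s t : ℝ} (ht : 0 < t) (hts : t < s)
    (hA : ∀ Q ∈ dyadicCubes Q₀, ENNReal.ofReal s * dyadicContent β Q₀ (A ∩ Q.toSet) ≤
      ENNReal.ofReal t * ENNReal.ofReal (Q.side ^ β))
    {Q : HalfOpenCube d} (hQ : Q ∈ dyadicCubes Q₀) : dyadicContent β Q₀ (A ∩ Q.toSet) = 0 := by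
  by_contra h0
  have hfin : dyadicContent β Q₀ (A ∩ Q.toSet) ≠ ∞ :=
    ne_top_of_le_ne_top ENNReal.ofReal_ne_top
      ((dyadicContent_mono inter_subset_right).trans (dyadicContent_toSet_le hβ hQ))
  have ht0 : ENNReal.ofReal t ≠ 0 := (ENNReal.ofReal_pos.2 ht).ne'
  -- Apply `hA` to every cube of a cover of A ∩ Q, sum, and take the infimum over covers. As s > t,
  -- a positive finite content is impossible.
  have hle : ENNReal.ofReal s * dyadicContent β Q₀ (A ∩ Q.toSet) ≤
      ENNReal.ofReal t * dyadicContent β Q₀ (A ∩ Q.toSet) := by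
    conv_rhs => rw [dyadicContent]
    simp only [ENNReal.mul_iInf_of_ne ht0 ENNReal.ofReal_ne_top]
    refine le_iInf₂ fun c hc => le_iInf fun hcov => ?_
    rw [← ENNReal.tsum_mul_left]
    refine le_trans ?_ (ENNReal.tsum_le_tsum fun i => hA _ (hc i))
    rw [ENNReal.tsum_mul_left]
    refine mul_le_mul_right ((dyadicContent_mono ?_).trans (dyadicContent_iUnion_le hβ _)) _
    rw [← inter_iUnion]
    exact subset_inter inter_subset_left hcov
  rw [ENNReal.mul_le_mul_iff_left h0 hfin, ENNReal.ofReal_le_ofReal_iff ht.le] at hle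
  exact hts.not_ge hle

open Filter Topology in
-- A cover with small sum has only small cubes, so the content, which does not restrict scales,
-- still controls null sets of the Hausdorff measure.
theorem hausdorffMeasure_eq_zero_of_dyadicContent_eq_zero {d : ℕ} (hd : 0 < d) {β : ℝ}
    (hβ : 0 < β) {Q₀ : HalfOpenCube d} {A : Set (EuclideanSpace ℝ (Fin d))}
    (hA : dyadicContent β Q₀ A = 0) : Measure.hausdorffMeasure β A = 0 := by
  have hd' : (0 : ℝ) < d := by exact_mod_cast hd
  let u : ℕ → ℝ := fun n => 1 / ((n : ℝ) + 1)
  have hu : ∀ n, 0 < u n := fun n => by positivity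
  have hu0 : Tendsto u atTop (𝓝 0) := tendsto_one_div_add_atTop_nhds_zero_nat
  have hlt : ∀ n, dyadicContent β Q₀ A < ENNReal.ofReal (u n ^ β) := fun n => by
    rw [hA]
    exact ENNReal.ofReal_pos.2 (Real.rpow_pos_of_pos (hu n) _)
  choose c _ hcov hsum using fun n => exists_cover_of_dyadicContent_lt (hlt n)
  have hside : ∀ n i, (c n i).side ≤ u n := fun n i => by
    have h1 := (ENNReal.le_tsum i).trans (hsum n).le
    rw [ENNReal.ofReal_le_ofReal_iff (Real.rpow_nonneg (hu n).le _)] at h1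
    exact (Real.rpow_le_rpow_iff (c n i).side_pos.le (hu n).le hβ).1 h1
  have hbound : ∀ n, ∑' i, Metric.ediam (c n i).toSet ^ β ≤ ENNReal.ofReal ((d * u n) ^ β) := by
    intro n
    calc ∑' i, Metric.ediam (c n i).toSet ^ β
        ≤ ∑' i, ENNReal.ofReal ((d : ℝ) ^ β) * ENNReal.ofReal ((c n i).side ^ β) := by
          refine ENNReal.tsum_le_tsum fun i => ?_
          have hs := (c n i).side_pos
          refine (ENNReal.rpow_le_rpow ((c n i).ediam_toSet_le hd) hβ.le).trans_eq ?_
          rw [ENNReal.ofReal_rpow_of_pos (by positivity), Real.mul_rpow hd'.le hs.le,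
            ENNReal.ofReal_mul (by positivity)]
      _ ≤ ENNReal.ofReal ((d * u n) ^ β) := by
          rw [ENNReal.tsum_mul_left, Real.mul_rpow hd'.le (hu n).le,
            ENNReal.ofReal_mul (by positivity)]
          exact mul_le_mul_right (hsum n).le _
  have hlim : Tendsto (fun n => ENNReal.ofReal (d * u n)) atTop (𝓝 0) := by
    have h := ENNReal.tendsto_ofReal (hu0.const_mul (d : ℝ))
    rwa [mul_zero, ENNReal.ofReal_zero] at h
  have hlim' : Tendsto (fun n => ENNReal.ofReal ((d * u n) ^ β)) atTop (𝓝 0) := by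
    have h := ENNReal.tendsto_ofReal ((hu0.const_mul (d : ℝ)).rpow_const (Or.inr hβ.le))
    rwa [mul_zero, Real.zero_rpow hβ.ne', ENNReal.ofReal_zero] at h
  refine le_antisymm ?_ zero_le
  refine (Measure.hausdorffMeasure_le_liminf_tsum β A (fun n => ENNReal.ofReal (d * u n)) hlim
    (fun n i => (c n i).toSet) (Eventually.of_forall fun n i => ?_)
    (Eventually.of_forall hcov)).trans ?_
  · exact ((c n i).ediam_toSet_le hd).trans (ENNReal.ofReal_le_ofReal
      (mul_le_mul_of_nonneg_left (hside n i) hd'.le))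
  · exact (liminf_le_liminf (Eventually.of_forall hbound)).trans_eq hlim'.liminf_eq

theorem toSet_subset_of_lt_dyadicAverage {d : ℕ} {β : ℝ} {Q₀ Q : HalfOpenCube d}
    {f : EuclideanSpace ℝ (Fin d) → ℝ} {a : ℝ≥0∞} (hQ : Q ∈ dyadicCubes Q₀)
    (h : a < dyadicAverage β Q₀ f Q) : Q.toSet ⊆ {x | a < dyadicMaximal β Q₀ f x} :=
  fun _ hx => h.trans_le (le_iSup₂_of_le Q hQ (le_iSup_of_le hx le_rfl))

theorem ae_abs_le_of_dyadicMaximal_le {d : ℕ} {β : ℝ} (hβ : 0 < β) (hβd : β ≤ (d : ℝ))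
    (Q₀ : HalfOpenCube d) (f : EuclideanSpace ℝ (Fin d) → ℝ) {t : ℝ} (ht : 0 < t) :
    ∀ᵐ x ∂(Measure.hausdorffMeasure β : Measure (EuclideanSpace ℝ (Fin d))),
      dyadicMaximal β Q₀ f x ≤ ENNReal.ofReal t → |f x| ≤ t := by
  have hd : 0 < d := by exact_mod_cast hβ.trans_le hβd
  let A : ℕ → Set (EuclideanSpace ℝ (Fin d)) := fun n =>
    {x | dyadicMaximal β Q₀ f x ≤ ENNReal.ofReal t ∧ t + 1 / ((n : ℝ) + 1) < |f x|}
  have hcontent : ∀ n, ∀ Q ∈ dyadicCubes Q₀, dyadicContent β Q₀ (A n ∩ Q.toSet) = 0 := by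
    intro n Q hQ
    refine dyadicContent_inter_eq_zero hβ ht
      (lt_add_of_pos_right t (by positivity : 0 < 1 / ((n : ℝ) + 1)))
      (fun R hR => ?_) hQ
    rcases (A n ∩ R.toSet).eq_empty_or_nonempty with h0 | ⟨x, hxA, hxR⟩
    · rw [h0, dyadicContent_empty hβ, mul_zero]
      exact zero_le
    · refine (ofReal_mul_le_choquetIntegral (g := fun x => |f x|) inter_subset_right fun y hy => hy.1.2).trans
        (le_of_not_gt fun h => ?_)
      exact hxA.1.not_gt (toSet_subset_of_lt_dyadicAverage hR (lt_dyadicAverage_iff.2 h) hxR)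
  have hnull : Measure.hausdorffMeasure β (⋃ n, ⋃ Q ∈ dyadicCubes Q₀, A n ∩ Q.toSet) = 0 :=
    measure_iUnion_null fun n => (measure_biUnion_null_iff (countable_dyadicCubes Q₀)).2
      fun Q hQ => hausdorffMeasure_eq_zero_of_dyadicContent_eq_zero hd hβ (hcontent n Q hQ)
  refine measure_mono_null (fun x hx => ?_) hnull
  simp only [mem_compl_iff, mem_ofPred_eq, Classical.not_imp, not_le] at hx
  obtain ⟨n, hn⟩ := exists_nat_one_div_lt (sub_pos.2 hx.2)
  -- Any generation would do: the cubes only localize A n to pieces of finite content.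
  obtain ⟨Q, hQ, -, hxQ⟩ := exists_dyadicCube_mem Q₀ 0 x
  exact mem_iUnion.2 ⟨n, mem_iUnion₂.2 ⟨Q, hQ, ⟨hx.1, by linarith⟩, hxQ⟩⟩

/-! ### The Calderón–Zygmund decomposition -/

theorem mainTheorem10 {d : ℕ} {β : ℝ} (hβ : 0 < β) (hβd : β ≤ (d : ℝ))
    (Q₀ : HalfOpenCube d) (f : EuclideanSpace ℝ (Fin d) → ℝ) {t : ℝ} (ht : 0 < t)
    (hfin : dyadicContent β Q₀ {x | ENNReal.ofReal t < dyadicMaximal β Q₀ f x} < ∞) :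
    ∃ 𝒬 : Set (HalfOpenCube d),
      𝒬.Countable ∧
      𝒬 ⊆ dyadicCubes Q₀ ∧
      (∀ Q ∈ 𝒬, ∀ R ∈ 𝒬, Q ≠ R → Disjoint Q.toSet R.toSet) ∧
      (⋃ Q ∈ 𝒬, Q.toSet) = {x | ENNReal.ofReal t < dyadicMaximal β Q₀ f x} ∧
      𝒬 = maximalDyadicCubes Q₀ {x | ENNReal.ofReal t < dyadicMaximal β Q₀ f x} ∧
      (∀ Q ∈ 𝒬, ENNReal.ofReal t < dyadicAverage β Q₀ f Q ∧
        dyadicAverage β Q₀ f Q ≤ ENNReal.ofReal ((2 : ℝ) ^ β * t)) ∧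
      ∀ᵐ x ∂(Measure.hausdorffMeasure β : Measure (EuclideanSpace ℝ (Fin d))),
        x ∉ (⋃ Q ∈ 𝒬, Q.toSet) → |f x| ≤ t := by
  have hd : 0 < d := by exact_mod_cast hβ.trans_le hβd
  set S := {x | ENNReal.ofReal t < dyadicMaximal β Q₀ f x} with hS
  let 𝓕 : Set (HalfOpenCube d) := {Q | Q ∈ dyadicCubes Q₀ ∧ Q.toSet ⊆ S}
  have h𝓕 : 𝓕 ⊆ dyadicCubes Q₀ := fun Q hQ => hQ.1
  have hside : ∀ Q ∈ 𝓕, Q.side ≤ (dyadicContent β Q₀ S).toReal ^ (1 / β) := by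
    intro Q hQ
    have h1 := (le_dyadicContent_toSet hβ hβd Q₀ Q).trans (dyadicContent_mono hQ.2)
    rw [ENNReal.ofReal_le_iff_le_toReal hfin.ne] at h1
    have h2 := Real.rpow_le_rpow (Real.rpow_nonneg Q.side_pos.le _) h1 (one_div_pos.2 hβ).le
    rwa [← Real.rpow_mul Q.side_pos.le, mul_one_div_cancel hβ.ne', Real.rpow_one] at h2
  have hmem : ∀ x ∈ S, ∃ Q ∈ dyadicCubes Q₀, x ∈ Q.toSet ∧ Q.toSet ⊆ S ∧
      ENNReal.ofReal t < dyadicAverage β Q₀ f Q := by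
    intro x hx
    have hx' : ENNReal.ofReal t < dyadicMaximal β Q₀ f x := hx
    simp only [dyadicMaximal, lt_iSup_iff] at hx'
    obtain ⟨Q, hQ, hxQ, hlt⟩ := hx'
    exact ⟨Q, hQ, hxQ, toSet_subset_of_lt_dyadicAverage hQ hlt, hlt⟩
  have hunion : (⋃ Q ∈ maximalDyadicCubes Q₀ S, Q.toSet) = S := by
    refine Subset.antisymm (iUnion₂_subset fun Q hQ => hQ.2.1) fun x hx => ?_
    obtain ⟨Q, hQ, hxQ, hQS, -⟩ := hmem x hx
    obtain ⟨M, hM, hQM, hmax⟩ := exists_maximal_dyadicCube hd h𝓕 hside (Q := Q) ⟨hQ, hQS⟩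
    exact mem_iUnion₂.2 ⟨M, ⟨hM.1, hM.2, fun R hR hRS => hmax R ⟨hR, hRS⟩⟩, hQM hxQ⟩
  refine ⟨maximalDyadicCubes Q₀ S, (countable_dyadicCubes Q₀).mono fun Q hQ => hQ.1,
    fun Q hQ => hQ.1, fun Q hQ R hR hne => ?_, hunion, rfl, fun Q hQ => ⟨?_, ?_⟩, ?_⟩
  · exact disjoint_of_maximal h𝓕 ⟨hQ.1, hQ.2.1⟩ ⟨hR.1, hR.2.1⟩
      (fun P hP => hQ.2.2 P hP.1 hP.2) (fun P hP => hR.2.2 P hP.1 hP.2) hne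
  · refine lt_dyadicAverage_of_cover hβ hβd fun x hx => ?_
    -- The cube R witnessing x ∈ S lies in S, so by maximality of Q it cannot be strictly larger
    -- than Q.
    obtain ⟨R, hR, hxR, hRS, hlt⟩ := hmem x (hQ.2.1 hx)
    refine ⟨R, hR, hxR, ?_, hlt⟩
    rcases dyadicCube_subset_or_subset hR hQ.1 hxR hx with h | h
    · exact h
    · rw [hQ.2.2 R hR hRS h]
  · obtain ⟨P, hP, hPs, hQP⟩ := exists_dyadicCube_parent hQ.1
    refine dyadicAverage_le_of_parent hPs hQP (le_of_not_gt fun h => ?_)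
    have hPQ := hQ.2.2 P hP (toSet_subset_of_lt_dyadicAverage hP h) hQP
    rw [hPQ] at hPs
    linarith [Q.side_pos]
  · rw [hunion]
    filter_upwards [ae_abs_le_of_dyadicMaximal_le hβ hβd Q₀ f ht] with x hx hxS
    exact hx (not_lt.1 hxS)
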